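/- Let $n$ be a nonnegative integer and work with complex matrices. Write $e_i$ for the standard basis vectors, $\circ$ for the entrywise product, and $C^{(-)}$ for the entrywise inverse of a matrix $C$ without zero entries, with $C^{(-)T}=(C^{(-)})^T$. For an $m\times m$ matrix $C$ let $X_C$ and $\Delta_C$ be the operators $X_C(M)=CM$ and $\Delta_C(M)=C\circ M$ on the space of $m\times m$ matrices. A pair $(A,B)$ of $n\times n$ matrices is a *one-sided Jones pair* if $X_A$ and $\Delta_B$ are invertible and $X_A\Delta_BX_A=\Delta_BX_A\Delta_B$; it is a *Jones pair* if both $(A,B)$ and $(A,B^T)$ are one-sided Jones pairs; a Jones pair is *invertible* if moreover $A$ has no zero entry and $B$ is an invertible matrix. For $m\times m$ matrices $A,B$ with $A$ invertible and $B$ without zero entries, $\mathcal N_{A,B}$ is the algebra of all matrices $M$ for which every vector $Ae_i\circ Be_j$ is an eigenvector; $\Theta_{A,B}(M)$ is the matrix whose $(i,j)$ entry is the eigenvalue of $M\in\mathcal N_{A,B}$ on $Ae_i\circ Be_j$; and $\mathcal N'_{A,B}=\Theta_{A,B}(\mathcal N_{A,B})$ is the dual space. Put $\mathcal N_A=\mathcal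 N_{A,A^{(-)}}$ (the Nomura algebra of $A$) and $\Theta_A=\Theta_{A,A^{(-)}}$. **Theorem.** Let $(A,B)$ be an invertible Jones pair of $n\times n$ matrices with $A$ symmetric, let $d$ be a complex number with $d^2=n$, and let $$V=\begin{pmatrix} dA&-dA&B^{(-)}&B^{(-)}\\ -dA&dA&B^{(-)}&B^{(-)}\\ B^{(-)T}&B^{(-)T}&dA&-dA\\ B^{(-)T}&B^{(-)T}&-dA&dA\end{pmatrix}.$$ Then $\mathcal N_V$ is equal to the set of all $4n\times4n$ matrices of the form $$\begin{pmatrix} F+R&F-R&G+H&G-H\\ F-R&F+R&G-H&G+H\\ B^{-1}GB^T+H_1&B^{-1}GB^T-H_1&B^{-1}FB+R_1&B^{-1}FB-R_1\\ B^{-1}GB^T-H_1&B^{-1}GB^T+H_1&B^{-1}FB-R_1&B^{-1}FB+R_1\end{pmatrix}$$ where $F,R,G,H,R_1,H_1$ are $n\times n$ matrices such that 1. $F\in\mathcal N_A$, $R\in\mathcal N_{A,B}$ and $G\in\mathcal N'_{A,B}$; 2. $A\circ R_1\in\mathcal N_{B^T}$, $A\circ R\in\mathcal N_A$ and $\Theta_{B^T}(A\circ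 R_1)^T=\Theta_A(A\circ R)$; 3. there exist $n\times n$ matrices $S$ and $S_1$ with $$X_{A^{-1}}\Delta_{B^{(-)}}X_H\Delta_{A^{(-)}}X_{B^{-1}}=\Delta_S=X_B\Delta_AX_{H_1}\Delta_BX_A,$$ $$X_{B^T}\Delta_AX_H\Delta_{B^T}X_A=\Delta_{S_1}=X_{A^{-1}}\Delta_{B^{(-)T}}X_{H_1}\Delta_{A^{(-)}}X_{(B^{-1})^T}.$$ -/

import Mathlib

open scoped Matrix

namespace JonesPair

section

variable {ι : Type*} [Fintype ι] [DecidableEq ι]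

/-- The operator `X_C : M ↦ C M` on square matrices. -/
def X (C : Matrix ι ι ℂ) : Module.End ℂ (Matrix ι ι ℂ) :=
  LinearMap.mulLeft ℂ C

/-- The operator `Δ_C : M ↦ C ∘ M` (entrywise product) on square matrices. -/
def Δ (C : Matrix ι ι ℂ) : Module.End ℂ (Matrix ι ι ℂ) where
  toFun M := C ⊙ M
  map_add' M N := Matrix.hadamard_add C M N
  map_smul' c M := Matrix.hadamard_smul C M c

/-- The Schur (entrywise) inverse `C^{(-)}`. -/
noncomputable def schurInv (C : Matrix ι ι ℂ) : Matrix ι ι ℂ :=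
  C.map (fun z => z⁻¹)

/-- All entries are nonzero, so that the Schur inverse really is an inverse. -/
def SchurInvertible (C : Matrix ι ι ℂ) : Prop :=
  ∀ i j, C i j ≠ 0

/-- `(A, B)` is a one-sided Jones pair: `X_A` and `Δ_B` are invertible and satisfy the
braid relation. -/
structure IsOneSidedJonesPair (A B : Matrix ι ι ℂ) : Prop where
  isUnit_X : IsUnit (X A)
  isUnit_Δ : IsUnit (Δ B)
  braid : X A * Δ B * X A = Δ B * X A * Δ B

/-- `(A, B)` is a Jones pair: both `(A, B)` and `(A, Bᵀ)` are one-sided Jones pairs. -/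
def IsJonesPair (A B : Matrix ι ι ℂ) : Prop :=
  IsOneSidedJonesPair A B ∧ IsOneSidedJonesPair A Bᵀ

/-- A Jones pair `(A, B)` is invertible if moreover `A` is Schur invertible and `B` is
invertible. -/
structure IsInvertibleJonesPair (A B : Matrix ι ι ℂ) : Prop where
  isJonesPair : IsJonesPair A B
  schurInvertible : SchurInvertible A
  isUnit : IsUnit B

/-- `N_{A,B}`: the algebra of matrices having every vector `A e_i ∘ B e_j` as an
eigenvector. -/
def nomuraPair (A B : Matrix ι ι ℂ) : Subalgebra ℂ (Matrix ι ι ℂ) where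
  carrier := {M | ∀ i j, ∃ c : ℂ, M *ᵥ (A.col i * B.col j) = c • (A.col i * B.col j)}
  mul_mem' := by
    intro M N hM hN i j
    obtain ⟨a, ha⟩ := hM i j
    obtain ⟨b, hb⟩ := hN i j
    exact ⟨b * a, by rw [← Matrix.mulVec_mulVec, hb, Matrix.mulVec_smul, ha, smul_smul]⟩
  add_mem' := by
    intro M N hM hN i j
    obtain ⟨a, ha⟩ := hM i j
    obtain ⟨b, hb⟩ := hN i j
    exact ⟨a + b, by rw [Matrix.add_mulVec, ha, hb, add_smul]⟩
  algebraMap_mem' := by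
    intro r i j
    exact ⟨r, by rw [Algebra.algebraMap_eq_smul_one, Matrix.smul_mulVec, Matrix.one_mulVec]⟩

/-- `Θ_{A,B} : N_{A,B} → M_n(ℂ)`: the `(i, j)` entry of `Θ_{A,B}(M)` is the eigenvalue of `M`
on `A e_i ∘ B e_j`. (It is unique whenever these vectors are nonzero, in particular when `A`
is invertible and `B` is Schur invertible.) -/
noncomputable def thetaPair (A B : Matrix ι ι ℂ) (M : nomuraPair A B) : Matrix ι ι ℂ :=
  Matrix.of fun i j => (M.2 i j).choose

/-- The dual space `N'_{A,B}`: the image of `N_{A,B}` under `Θ_{A,B}`. -/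
def dualNomuraPair (A B : Matrix ι ι ℂ) : Set (Matrix ι ι ℂ) :=
  Set.range (thetaPair A B)

/-- The Nomura algebra `N_A = N_{A, A^{(-)}}`. -/
noncomputable def nomura (A : Matrix ι ι ℂ) : Subalgebra ℂ (Matrix ι ι ℂ) :=
  nomuraPair A (schurInv A)

/-- `Θ_A = Θ_{A, A^{(-)}}`. -/
noncomputable def theta (A : Matrix ι ι ℂ) (M : nomura A) : Matrix ι ι ℂ :=
  thetaPair A (schurInv A) M

/-- The `4n × 4n` matrix with the sixteen given `n × n` blocks, listed row by row. -/
def blocks4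
    (a₁ a₂ a₃ a₄ b₁ b₂ b₃ b₄ c₁ c₂ c₃ c₄ d₁ d₂ d₃ d₄ : Matrix ι ι ℂ) :
    Matrix ((ι ⊕ ι) ⊕ (ι ⊕ ι)) ((ι ⊕ ι) ⊕ (ι ⊕ ι)) ℂ :=
  Matrix.fromBlocks
    (Matrix.fromBlocks a₁ a₂ b₁ b₂) (Matrix.fromBlocks a₃ a₄ b₃ b₄)
    (Matrix.fromBlocks c₁ c₂ d₁ d₂) (Matrix.fromBlocks c₃ c₄ d₃ d₄)

/-- The `4n × 4n` matrix `V` built from `(A, B)` and the loop variable `d`. -/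
noncomputable def V (A B : Matrix ι ι ℂ) (d : ℂ) :
    Matrix ((ι ⊕ ι) ⊕ (ι ⊕ ι)) ((ι ⊕ ι) ⊕ (ι ⊕ ι)) ℂ :=
  blocks4
    (d • A)         (-(d • A))      (schurInv B) (schurInv B)
    (-(d • A))      (d • A)         (schurInv B) (schurInv B)
    (schurInv B)ᵀ   (schurInv B)ᵀ   (d • A)      (-(d • A))
    (schurInv B)ᵀ   (schurInv B)ᵀ   (-(d • A))   (d • A)

end

end JonesPair

namespace JonesPair

set_option linter.unusedSectionVars false

/-! ### Calculus of the relation `Maps` between families of entrywise products of columns. -/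

section

variable {ι : Type*} [Fintype ι] [DecidableEq ι]

/-! Everything is phrased through `Maps`: a matrix carries one family of column products to another,
up to scalars collected in a coefficient matrix. Over a type II matrix, `Maps.exchange` swaps the
operator with its coefficient matrix; this is the source of all dualities.

Put x = (A e_i ∘ A^{(-)} e_j), y = (B^{(-)T} e_i ∘ B^T e_j) and y' = (B^{(-)} e_i ∘ B e_j). In an
invertible Jones pair both matrices are type II, and exchanging the braid relations shows that B
carries y to x and x to y', while B^T carries y' to x and x to y, always with coefficients n A_ij
(`Intertwined`).

The vectors V e_a ∘ V^{(-)} e_b span, and each is fixed or negated by the permutation that swaps the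
halves of every 2n-block. So each element of N_V commutes with this permutation, and splits into
[[F, G], [G₁, F₁]] on symmetric vectors (p, p, q, q) and [[R, H], [H₁, R₁]] on antisymmetric vectors
(p, -p, q, -q). Since all sign choices of p and q occur, diagonal and off-diagonal blocks obey
separate `Maps` relations (`forall_sign_iff`).

On the symmetric side F₁ and G₁ are forced by transporting F and G along B and B^T, and the
relations that involve y' are automatic (`Intertwined.mapsPair_symm_iff`). On the antisymmetric
side, exchange turns the relations for R, R₁ into condition 2, and those for H, H₁ are condition 3
rescaled with d² = n (`Intertwined.mapsPair_antisymm_iff`). -/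

/-- `G` sends each vector `P e_i ∘ Q e_j` to `T i j` times the vector `P' e_i ∘ Q' e_j`. -/
def Maps (G P Q P' Q' T : Matrix ι ι ℂ) : Prop :=
  ∀ i j, G *ᵥ (P.col i * Q.col j) = T i j • (P'.col i * Q'.col j)

/-- `W` is a type II matrix: it has no zero entry and `W W^{(-)T} = n I`. -/
structure IsTypeII (W : Matrix ι ι ℂ) : Prop where
  schurInvertible : SchurInvertible W
  mul_schurInv : W * (schurInv W)ᵀ = (Fintype.card ι : ℂ) • 1

theorem schurInv_apply (C : Matrix ι ι ℂ) (i j : ι) : schurInv C i j = (C i j)⁻¹ := rfl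

theorem schurInv_schurInv (C : Matrix ι ι ℂ) : schurInv (schurInv C) = C := by
  ext i j; simp [schurInv_apply]

theorem schurInv_transpose (C : Matrix ι ι ℂ) : schurInv Cᵀ = (schurInv C)ᵀ := rfl

theorem SchurInvertible.schurInv {C : Matrix ι ι ℂ} (h : SchurInvertible C) :
    SchurInvertible (schurInv C) := fun i j => inv_ne_zero (h i j)

theorem SchurInvertible.transpose {C : Matrix ι ι ℂ} (h : SchurInvertible C) :
    SchurInvertible Cᵀ := fun i j => h j i

theorem SchurInvertible.smul {C : Matrix ι ι ℂ} (h : SchurInvertible C) {c : ℂ} (hc : c ≠ 0) :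
    SchurInvertible (c • C) := fun i j => mul_ne_zero hc (h i j)

theorem hadamard_schurInv {C : Matrix ι ι ℂ} (hC : SchurInvertible C) (T : Matrix ι ι ℂ) :
    C ⊙ T ⊙ schurInv C = T := by
  ext i j
  have := hC i j
  simp only [Matrix.hadamard_apply, schurInv_apply]
  field_simp

theorem maps_iff {G P Q P' Q' T : Matrix ι ι ℂ} :
    Maps G P Q P' Q' T ↔
      ∀ i j k, ∑ l, G k l * (P l i * Q l j) = T i j * (P' k i * Q' k j) := by
  simp only [Maps, funext_iff, Matrix.mulVec, dotProduct, Pi.mul_apply, Pi.smul_apply,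
    Matrix.col_apply, smul_eq_mul]

theorem Maps.swap {G P Q P' Q' T : Matrix ι ι ℂ} (h : Maps G P Q P' Q' T) :
    Maps G Q P Q' P' Tᵀ := by
  intro i j
  rw [mul_comm (Q.col i), mul_comm (Q'.col i)]
  exact h j i

theorem Maps.smul {G P Q P' Q' T : Matrix ι ι ℂ} (h : Maps G P Q P' Q' T) (c : ℂ) :
    Maps (c • G) P Q P' Q' (c • T) := by
  intro i j
  rw [Matrix.smul_mulVec, h i j, smul_smul]
  rfl

theorem Maps.of_smul {G P Q P' Q' T : Matrix ι ι ℂ} {c : ℂ} (hc : c ≠ 0)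
    (h : Maps (c • G) P Q P' Q' (c • T)) : Maps G P Q P' Q' T := by
  simpa [smul_smul, inv_mul_cancel₀ hc] using h.smul c⁻¹

theorem Maps.comp {G G' P Q P' Q' P'' Q'' T T' : Matrix ι ι ℂ}
    (h' : Maps G' P' Q' P'' Q'' T') (h : Maps G P Q P' Q' T) :
    Maps (G' * G) P Q P'' Q'' (T ⊙ T') := by
  intro i j
  rw [← Matrix.mulVec_mulVec, h i j, Matrix.mulVec_smul, h' i j, smul_smul]
  rfl

theorem Maps.inv {G P Q P' Q' T : Matrix ι ι ℂ} (h : Maps G P Q P' Q' T) (hG : IsUnit G)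
    (hT : SchurInvertible T) : Maps G⁻¹ P' Q' P Q (schurInv T) := by
  intro i j
  have h1 : P'.col i * Q'.col j = (T i j)⁻¹ • G *ᵥ (P.col i * Q.col j) := by
    rw [h i j, smul_smul, inv_mul_cancel₀ (hT i j), one_smul]
  rw [h1, Matrix.mulVec_smul, Matrix.mulVec_mulVec,
    Matrix.nonsing_inv_mul _ ((Matrix.isUnit_iff_isUnit_det _).1 hG), Matrix.one_mulVec]
  rfl

/-- Scaling the first factor of the source vectors. -/
theorem maps_smul_source {G P Q P' Q' T : Matrix ι ι ℂ} {c : ℂ} (hc : c ≠ 0) :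
    Maps G (c • P) Q P' Q' T ↔ Maps G P Q P' Q' (c⁻¹ • T) := by
  refine forall₂_congr fun i j => ?_
  have : (c • P).col i * Q.col j = c • (P.col i * Q.col j) := by
    ext k; simp [mul_assoc]
  rw [this, Matrix.mulVec_smul, Matrix.smul_apply, smul_assoc, eq_inv_smul_iff₀ hc]

/-- Scaling the first factor of the target vectors. -/
theorem maps_smul_target {G P Q P' Q' T : Matrix ι ι ℂ} {c : ℂ} :
    Maps G P Q (c • P') Q' T ↔ Maps G P Q P' Q' (c • T) := by
  refine forall₂_congr fun i j => ?_
  have : T i j • ((c • P').col i * Q'.col j) = (c • T) i j • (P'.col i * Q'.col j) := by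
    ext k; simp; ring
  rw [this]

theorem Maps.congr_right {G P Q P' Q' T T' : Matrix ι ι ℂ} (h : Maps G P Q P' Q' T)
    (e : T = T') : Maps G P Q P' Q' T' := e ▸ h

theorem Maps.coeff_unique {G P Q P' Q' T T' : Matrix ι ι ℂ} (h : Maps G P Q P' Q' T)
    (h' : Maps G P Q P' Q' T') (hP : SchurInvertible P') (hQ : SchurInvertible Q') : T = T' := by
  rw [maps_iff] at h h'
  ext i j
  exact mul_right_cancel₀ (mul_ne_zero (hP i i) (hQ i j)) ((h i j i).symm.trans (h' i j i))

/-- The vectors `P e_i ∘ Q e_j` span if `P` is invertible and `Q` has no zero entry. -/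
theorem eq_of_mulVec_eq {κ : Type*} {G G' : Matrix κ ι ℂ} {P Q : Matrix ι ι ℂ} (hP : IsUnit P)
    (hQ : SchurInvertible Q)
    (h : ∀ i j, G *ᵥ (P.col i * Q.col j) = G' *ᵥ (P.col i * Q.col j)) : G = G' := by
  ext k l
  -- With l fixed, the k-th coordinates of D(P e_i ∘ Q e_l) form the row vector (D_km Q_ml)_m times
  -- P. Invertibility of P recovers that row vector, and then Q_ll is cancelled.
  have h1 : ∀ D : Matrix κ ι ℂ, ∀ i, (Matrix.vecMul (fun m => D k m * Q m l) P) i =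
      (D *ᵥ (P.col i * Q.col l)) k := by
    intro D i
    simp only [Matrix.vecMul, Matrix.mulVec, dotProduct, Pi.mul_apply, Matrix.col_apply]
    exact Finset.sum_congr rfl fun _ _ => by ring
  have h2 : (fun m => G k m * Q m l) = fun m => G' k m * Q m l :=
    Matrix.vecMul_injective_of_isUnit hP (funext fun i => by
      show Matrix.vecMul _ P i = Matrix.vecMul _ P i
      rw [h1, h1, h])
  exact mul_right_cancel₀ (hQ l l) (congrFun h2 l)

theorem Maps.unique {G G' P Q P' Q' T : Matrix ι ι ℂ} (h : Maps G P Q P' Q' T)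
    (h' : Maps G' P Q P' Q' T) (hP : IsUnit P) (hQ : SchurInvertible Q) : G = G' :=
  eq_of_mulVec_eq hP hQ fun i j => (h i j).trans (h' i j).symm

/-! ### Type II matrices and the exchange lemma. -/

section TypeII

variable [Nonempty ι]

theorem card_ne_zero_complex : (Fintype.card ι : ℂ) ≠ 0 :=
  Nat.cast_ne_zero.2 Fintype.card_ne_zero

theorem IsTypeII.isUnit {W : Matrix ι ι ℂ} (h : IsTypeII W) : IsUnit W := by
  refine IsUnit.of_mul_eq_one ((Fintype.card ι : ℂ)⁻¹ • (schurInv W)ᵀ) ?_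
  rw [Matrix.mul_smul, h.mul_schurInv, smul_smul, inv_mul_cancel₀ card_ne_zero_complex, one_smul]

theorem IsTypeII.inv_eq {W : Matrix ι ι ℂ} (h : IsTypeII W) :
    W⁻¹ = (Fintype.card ι : ℂ)⁻¹ • (schurInv W)ᵀ := by
  refine Matrix.inv_eq_right_inv ?_
  rw [Matrix.mul_smul, h.mul_schurInv, smul_smul, inv_mul_cancel₀ card_ne_zero_complex, one_smul]

theorem IsTypeII.schurInv_mul {W : Matrix ι ι ℂ} (h : IsTypeII W) :
    (JonesPair.schurInv W)ᵀ * W = (Fintype.card ι : ℂ) • 1 := by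
  have h1 := Matrix.nonsing_inv_mul _ ((Matrix.isUnit_iff_isUnit_det _).1 h.isUnit)
  rw [h.inv_eq, Matrix.smul_mul] at h1
  rw [← h1, smul_smul, mul_inv_cancel₀ card_ne_zero_complex, one_smul]

theorem IsTypeII.transpose {W : Matrix ι ι ℂ} (h : IsTypeII W) : IsTypeII Wᵀ where
  schurInvertible := h.schurInvertible.transpose
  mul_schurInv := by
    rw [schurInv_transpose, ← Matrix.transpose_mul, h.schurInv_mul]
    simp

theorem IsTypeII.schurInv {W : Matrix ι ι ℂ} (h : IsTypeII W) : IsTypeII (schurInv W) where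
  schurInvertible := h.schurInvertible.schurInv
  mul_schurInv := by
    rw [schurInv_schurInv]
    simpa using congrArg Matrix.transpose h.mul_schurInv

/-- The exchange lemma. -/
theorem Maps.exchange {G P Q P' Q' T : Matrix ι ι ℂ} (h : Maps G P Q P' Q' T) (hQ : IsTypeII Q)
    (hP : SchurInvertible P') :
    Maps T Q'ᵀ (JonesPair.schurInv Q)ᵀ (JonesPair.schurInv P')ᵀ Pᵀ ((Fintype.card ι : ℂ) • G) := by
  rw [maps_iff] at h ⊢
  intro k m i
  have h1 : ∀ l, ∑ j, Q l j * (Q m j)⁻¹ = if l = m then (Fintype.card ι : ℂ) else 0 := by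
    intro l
    have := congrFun (congrFun hQ.mul_schurInv l) m
    simpa [Matrix.mul_apply, schurInv_apply, Matrix.one_apply] using this
  -- Dividing the defining identity by Q_mj and summing over j, orthogonality of the rows of Q
  -- leaves only the term l = m on the left.
  have h2 : (∑ j, T i j * (Q' k j * (Q m j)⁻¹)) * P' k i = Fintype.card ι * G k m * P m i := by
    calc _ = ∑ j, (T i j * (P' k i * Q' k j)) * (Q m j)⁻¹ := by
            rw [Finset.sum_mul]; exact Finset.sum_congr rfl fun _ _ => by ring
      _ = ∑ j, ∑ l, G k l * P l i * (Q l j * (Q m j)⁻¹) := by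
            refine Finset.sum_congr rfl fun j _ => ?_
            rw [← h, Finset.sum_mul]
            exact Finset.sum_congr rfl fun _ _ => by ring
      _ = ∑ l, G k l * P l i * (if l = m then (Fintype.card ι : ℂ) else 0) := by
            rw [Finset.sum_comm]
            refine Finset.sum_congr rfl fun l _ => ?_
            rw [← Finset.mul_sum, h1]
      _ = _ := by simp; ring
  simp only [Matrix.transpose_apply, schurInv_apply, Matrix.smul_apply, smul_eq_mul]
  rw [← mul_left_inj' (hP k i), h2]
  field_simp [hP k i]

end TypeII

/-! ### Translation to the operators X and Δ. -/

/-- Operator form of `Maps`. -/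
theorem maps_iff_operator {G P Q P' Q' T : Matrix ι ι ℂ} :
    Maps G P Q P' Q' T ↔ X G * Δ Q * X P = Δ Q' * X P' * Δ T := by
  rw [maps_iff]
  have key : ∀ (M : Matrix ι ι ℂ) (k j : ι), (G * (Q ⊙ (P * M))) k j =
      ∑ i, (∑ l, G k l * (P l i * Q l j)) * M i j := by
    intro M k j
    simp only [Matrix.mul_apply, Matrix.hadamard_apply, Finset.mul_sum, Finset.sum_mul]
    rw [Finset.sum_comm]
    exact Finset.sum_congr rfl fun _ _ => Finset.sum_congr rfl fun _ _ => by ring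
  have key' : ∀ (M : Matrix ι ι ℂ) (k j : ι), (Q' ⊙ (P' * (T ⊙ M))) k j =
      ∑ i, (T i j * (P' k i * Q' k j)) * M i j := by
    intro M k j
    simp only [Matrix.mul_apply, Matrix.hadamard_apply, Finset.mul_sum]
    exact Finset.sum_congr rfl fun _ _ => by ring
  constructor
  · intro h
    refine LinearMap.ext fun M => ?_
    show G * (Q ⊙ (P * M)) = Q' ⊙ (P' * (T ⊙ M))
    ext k j
    rw [key, key']
    exact Finset.sum_congr rfl fun i _ => by rw [h]
  · intro h i j k
    have h1 : G * (Q ⊙ (P * Matrix.single i j 1)) = Q' ⊙ (P' * (T ⊙ Matrix.single i j 1)) :=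
      LinearMap.congr_fun h (Matrix.single i j 1)
    have h2 := congrFun (congrFun h1 k) j
    rw [key, key'] at h2
    simpa [Matrix.single_apply] using h2

theorem X_mul_X (C D : Matrix ι ι ℂ) : X C * X D = X (C * D) := by
  refine LinearMap.ext fun M => ?_
  exact (Matrix.mul_assoc C D M).symm

theorem X_one : X (1 : Matrix ι ι ℂ) = 1 :=
  LinearMap.ext fun M => Matrix.one_mul M

theorem Δ_mul_schurInv {C : Matrix ι ι ℂ} (hC : SchurInvertible C) : Δ C * Δ (schurInv C) = 1 := by
  refine LinearMap.ext fun M => ?_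
  show C ⊙ (schurInv C ⊙ M) = M
  ext i j
  simp [schurInv_apply, hC i j]

theorem schurInvertible_of_isUnit_Δ {C : Matrix ι ι ℂ} (h : IsUnit (Δ C)) :
    SchurInvertible C := by
  obtain ⟨u, hu⟩ := h
  intro i j hij
  have h1 : Δ C (Matrix.single i j 1) = 0 := by
    show C ⊙ Matrix.single i j 1 = 0
    ext k l
    by_cases h : i = k ∧ j = l
    · obtain ⟨rfl, rfl⟩ := h; simp [hij]
    · simp [h]
  have h2 : (Matrix.single i j 1 : Matrix ι ι ℂ) = 0 := by
    have h3 := LinearMap.congr_fun (Units.inv_mul u) (Matrix.single i j 1)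
    rw [hu] at h3
    rw [Module.End.mul_apply, h1, map_zero] at h3
    exact h3.symm
  simpa using congrFun (congrFun h2 i) j

theorem isUnit_of_isUnit_X {C : Matrix ι ι ℂ} (h : IsUnit (X C)) : IsUnit C := by
  obtain ⟨u, hu⟩ := h
  have h3 := LinearMap.congr_fun (Units.mul_inv u) 1
  rw [hu] at h3
  exact IsUnit.of_mul_eq_one _ h3

/-- X_C Δ_D has inverse Δ_{D^{(-)}} X_{C'}; moving it to the other side leaves the operator form of
`Maps`. All four equations of condition 3 have this shape. -/
theorem operator_iff_maps {C C' D D' H P Q S : Matrix ι ι ℂ}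
    (hC : C * C' = 1) (hD : SchurInvertible D) (hD' : schurInv D = D') :
    X C * Δ D * X H * Δ Q * X P = Δ S ↔ Maps H P Q C' D' S := by
  subst hD'
  have hC' : C' * C = 1 := mul_eq_one_comm.1 hC
  have h1 : (X C * Δ D) * (Δ (schurInv D) * X C') = 1 := by
    rw [mul_assoc, ← mul_assoc (Δ D), Δ_mul_schurInv hD, one_mul, X_mul_X, hC, X_one]
  have h2 : (Δ (schurInv D) * X C') * (X C * Δ D) = 1 := by
    have h3 := Δ_mul_schurInv hD.schurInv
    rw [schurInv_schurInv] at h3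
    rw [mul_assoc, ← mul_assoc (X C'), X_mul_X, hC', X_one, one_mul, h3]
  rw [maps_iff_operator]
  constructor
  · intro h
    rw [← h, ← mul_assoc, ← mul_assoc, ← mul_assoc, h2, one_mul]
  · intro h
    have : X C * Δ D * X H * Δ Q * X P = X C * Δ D * (X H * Δ Q * X P) := by
      simp only [mul_assoc]
    rw [this, h, ← mul_assoc, h1, one_mul]

end

section

variable {ι : Type*} [Fintype ι] [DecidableEq ι]

/-! ### Both matrices of an invertible Jones pair are type II. -/

section TypeII

variable [Nonempty ι] {A B : Matrix ι ι ℂ}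

/-- The first matrix of a one-sided Jones pair is type II, under the invertibility conditions. -/
theorem isTypeII_fst (h : Maps A A B A B B) (hA : IsUnit A) (hB : IsUnit B)
    (hA' : SchurInvertible A) (hB' : SchurInvertible B) : IsTypeII A := by
  have hAd := (Matrix.isUnit_iff_isUnit_det _).1 hA
  have hBd := (Matrix.isUnit_iff_isUnit_det _).1 hB
  have h1 := h.inv hA hB'
  rw [maps_iff] at h1
  -- Coordinate i of A⁻¹(A e_i ∘ B e_j) = B_ij⁻¹ (A e_i ∘ B e_j): the entries of B cancel and the
  -- right side no longer depends on j. Inverting B then gives A⁻¹_ik A_ki = A_ii c_k.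
  have h2 : ∀ i, Matrix.vecMul (fun k => A⁻¹ i k * A k i) B = fun _ => A i i := by
    intro i
    ext j
    have h3 := h1 i j i
    rw [schurInv_apply, mul_comm (A i i), ← mul_assoc, inv_mul_cancel₀ (hB' i j), one_mul] at h3
    rw [← h3]
    simp only [Matrix.vecMul, dotProduct]
    exact Finset.sum_congr rfl fun _ _ => by ring
  set c : ι → ℂ := Matrix.vecMul (fun _ => 1) B⁻¹ with hc
  have h3 : ∀ i k, A⁻¹ i k * A k i = A i i * c k := by
    intro i k
    have h4 : (fun _ : ι => A i i) = A i i • fun _ => (1 : ℂ) := by ext; simp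
    have h5 := congrArg (fun v => Matrix.vecMul v B⁻¹) (h2 i)
    simp only [Matrix.vecMul_vecMul, Matrix.mul_nonsing_inv _ hBd, Matrix.vecMul_one, h4,
      Matrix.smul_vecMul] at h5
    exact congrFun h5 k
  have h4 : ∀ i, A i i * ∑ k, c k = 1 := by
    intro i
    rw [Finset.mul_sum, ← Finset.sum_congr rfl fun k _ => h3 i k, ← Matrix.mul_apply,
      Matrix.nonsing_inv_mul _ hAd, Matrix.one_apply_eq]
  -- Summing over k shows that A has constant diagonal, so A⁻¹_ik A_ki depends on k alone; summing
  -- over the other index shows that it equals 1/n.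
  have h5 : ∀ i k, A⁻¹ i k * A k i * Fintype.card ι = 1 := by
    intro i k
    have h6 : ∀ l, A l l = A i i := fun l =>
      mul_right_cancel₀ (right_ne_zero_of_mul_eq_one (h4 i)) ((h4 l).trans (h4 i).symm)
    have h7 : ∑ l, A⁻¹ l k * A k l = 1 := by
      simp_rw [mul_comm (A⁻¹ _ k)]
      rw [← Matrix.mul_apply, Matrix.mul_nonsing_inv _ hAd, Matrix.one_apply_eq]
    rw [← h7, Finset.sum_congr rfl fun l _ => (h3 l k).trans (by rw [h6 l, ← h3 i k]),
      Finset.sum_const, nsmul_eq_mul, mul_comm]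
    rfl
  refine ⟨hA', ?_⟩
  have h6 : (schurInv A)ᵀ = (Fintype.card ι : ℂ) • A⁻¹ := by
    ext i k
    rw [Matrix.transpose_apply, schurInv_apply, Matrix.smul_apply, smul_eq_mul]
    exact inv_eq_of_mul_eq_one_left (by rw [← h5 i k]; ring)
  rw [h6, Matrix.mul_smul, Matrix.mul_nonsing_inv _ hAd]

/-- The second matrix of a one-sided Jones pair is type II, under the invertibility conditions. -/
theorem isTypeII_snd (h : Maps A A B A B B) (hA : IsUnit A) (hB : IsUnit B)
    (hA' : SchurInvertible A) (hB' : SchurInvertible B) : IsTypeII B := by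
  have hBd := (Matrix.isUnit_iff_isUnit_det _).1 hB
  rw [maps_iff] at h
  -- With C the diagonal matrix of A e_i, the columns of C B diagonalise A with eigenvalues the i-th
  -- row of B, so every row sum of B is the trace of A.
  have hrow : ∀ i, ∑ j, B i j = A.trace := by
    intro i
    set C : Matrix ι ι ℂ := Matrix.diagonal (fun k => A k i)
    have hC : IsUnit C := Matrix.isUnit_diagonal.2
      (Pi.isUnit_iff.2 fun k => (hA' k i).isUnit)
    have hCd := (Matrix.isUnit_iff_isUnit_det _).1 (hC.mul hB)
    have h1 : A * (C * B) = (C * B) * Matrix.diagonal (B i) := by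
      ext k j
      simp only [C, Matrix.mul_diagonal, Matrix.mul_apply (M := A), Matrix.diagonal_mul]
      rw [h i j k]; ring
    have h2 : A = (C * B) * Matrix.diagonal (B i) * (C * B)⁻¹ := by
      rw [← h1, Matrix.mul_assoc, Matrix.mul_nonsing_inv _ hCd, Matrix.mul_one]
    rw [h2, Matrix.trace_mul_comm, ← Matrix.mul_assoc, Matrix.nonsing_inv_mul _ hCd,
      Matrix.one_mul, Matrix.trace_diagonal]
  refine ⟨hB', ?_⟩
  ext k l
  -- After A is cancelled, the entries k ≠ l say A_lk ∑_j B_kj / B_lj = 0, and A_lk is nonzero: the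
  -- rows are orthogonal. The diagonal entries of B B^{(-)T} are n trivially.
  have h1 : Matrix.vecMul (fun k => A l k * ∑ j, B k j * (B l j)⁻¹) A =
      Matrix.vecMul (Pi.single l A.trace) A := by
    ext i
    rw [Matrix.single_vecMul]
    simp only [Matrix.vecMul, dotProduct, Pi.smul_apply, Matrix.row_apply, smul_eq_mul]
    calc _ = ∑ j, (∑ k, A l k * (A k i * B k j)) * (B l j)⁻¹ := by
            simp only [Finset.mul_sum, Finset.sum_mul]
            rw [Finset.sum_comm]
            exact Finset.sum_congr rfl fun _ _ => Finset.sum_congr rfl fun _ _ => by ring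
      _ = ∑ j, B i j * A l i := by
            refine Finset.sum_congr rfl fun j _ => ?_
            rw [h i j l]
            field_simp [hB' l j]
      _ = _ := by rw [← Finset.sum_mul, hrow]
  have h2 := congrFun (Matrix.vecMul_injective_of_isUnit hA h1) k
  simp only [Matrix.mul_apply, Matrix.transpose_apply, schurInv_apply, Matrix.smul_apply,
    smul_eq_mul]
  by_cases hkl : k = l
  · subst hkl
    simp [hB' k]
  · rw [Pi.single_eq_of_ne hkl] at h2
    rw [(mul_eq_zero.1 h2).resolve_left (hA' l k), Matrix.one_apply_ne hkl, mul_zero]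

theorem maps_of_isOneSidedJonesPair (h : IsOneSidedJonesPair A B) : Maps A A B A B B :=
  maps_iff_operator.2 h.braid

end TypeII

/-! ### Transport between the families x, y, y' along B and B^T. -/

/-- `A` is symmetric, `A` and `B` are type II, and `B` and `Bᵀ` permute up to the scalars `n A i j`
the families `x = (A, A^{(-)})` and `y = (B^{(-)}, B)` or its transposed version. -/
structure Intertwined (A B : Matrix ι ι ℂ) : Prop where
  symm : Aᵀ = A
  left : IsTypeII A
  right : IsTypeII B
  map_B_yx : Maps B (schurInv B)ᵀ Bᵀ A (schurInv A) ((Fintype.card ι : ℂ) • A)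
  map_B_xy : Maps B A (schurInv A) (schurInv B) B ((Fintype.card ι : ℂ) • A)
  map_Bt_yx : Maps Bᵀ (schurInv B) B A (schurInv A) ((Fintype.card ι : ℂ) • A)
  map_Bt_xy : Maps Bᵀ A (schurInv A) (schurInv B)ᵀ Bᵀ ((Fintype.card ι : ℂ) • A)

variable [Nonempty ι] {A B : Matrix ι ι ℂ}

theorem maps_snd_of_maps (h : Maps A A B A B B) (hA : IsTypeII A) (hB : IsTypeII B) (hs : Aᵀ = A) :
    Maps B (schurInv B)ᵀ Bᵀ A (schurInv A) ((Fintype.card ι : ℂ) • A) := by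
  have h1 := (h.exchange hB hA.schurInvertible).swap
  rwa [← schurInv_transpose A, Matrix.transpose_smul, hs] at h1

/-- The same braid relation as in `maps_snd_of_maps`, now exchanged through the factor A instead of
B; hence the transpose of B appears as the operator. -/
theorem maps_transpose_snd_of_maps (h : Maps A A B A B B) (hA : IsTypeII A) (hB : IsTypeII B)
    (hs : Aᵀ = A) :
    Maps Bᵀ A (schurInv A) (schurInv B)ᵀ Bᵀ ((Fintype.card ι : ℂ) • A) := by
  have h1 := h.swap.exchange hA hB.schurInvertible
  rwa [← schurInv_transpose A, hs] at h1

theorem IsInvertibleJonesPair.intertwined (h : IsInvertibleJonesPair A B) (hs : A.IsSymm) :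
    Intertwined A B := by
  have h1 := maps_of_isOneSidedJonesPair h.isJonesPair.1
  have h2 := maps_of_isOneSidedJonesPair h.isJonesPair.2
  have hA := isUnit_of_isUnit_X h.isJonesPair.1.isUnit_X
  have hB' := schurInvertible_of_isUnit_Δ h.isJonesPair.1.isUnit_Δ
  have hAt := isTypeII_fst h1 hA h.isUnit h.schurInvertible hB'
  have hBt := isTypeII_snd h1 hA h.isUnit h.schurInvertible hB'
  exact
    { symm := hs
      left := hAt
      right := hBt
      map_B_yx := maps_snd_of_maps h1 hAt hBt hs
      map_B_xy := by
        simpa [schurInv_transpose] using maps_transpose_snd_of_maps h2 hAt hBt.transpose hs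
      map_Bt_yx := by simpa [schurInv_transpose] using maps_snd_of_maps h2 hAt hBt.transpose hs
      map_Bt_xy := maps_transpose_snd_of_maps h1 hAt hBt hs }

namespace Intertwined

theorem transpose (h : Intertwined A B) : Intertwined A Bᵀ where
  symm := h.symm
  left := h.left
  right := h.right.transpose
  map_B_yx := by simpa [schurInv_transpose] using h.map_Bt_yx
  map_B_xy := by simpa [schurInv_transpose] using h.map_Bt_xy
  map_Bt_yx := by simpa [schurInv_transpose] using h.map_B_yx
  map_Bt_xy := by simpa [schurInv_transpose] using h.map_B_xy

theorem schurInvertible_coeff (h : Intertwined A B) :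
    SchurInvertible ((Fintype.card ι : ℂ) • A) :=
  h.left.schurInvertible.smul card_ne_zero_complex

variable {F G S T : Matrix ι ι ℂ}

/-- In this and the next three lemmas the coefficients n A_ij of the incoming map cancel against
those of the inverse map, so the coefficient matrix is unchanged. -/
theorem conj_yy (h : Intertwined A B) (hF : Maps F A (schurInv A) A (schurInv A) S) :
    Maps (B⁻¹ * F * B) (schurInv B)ᵀ Bᵀ (schurInv B)ᵀ Bᵀ S := by
  have h1 := (h.map_B_yx.inv h.right.isUnit h.schurInvertible_coeff).comp (hF.comp h.map_B_yx)
  rw [← Matrix.mul_assoc] at h1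
  exact h1.congr_right (hadamard_schurInv h.schurInvertible_coeff S)

theorem conj_xx (h : Intertwined A B) (hF : Maps F (schurInv B) B (schurInv B) B S) :
    Maps (B⁻¹ * F * B) A (schurInv A) A (schurInv A) S := by
  have h1 := (h.map_B_xy.inv h.right.isUnit h.schurInvertible_coeff).comp (hF.comp h.map_B_xy)
  rw [← Matrix.mul_assoc] at h1
  exact h1.congr_right (hadamard_schurInv h.schurInvertible_coeff S)

theorem conj_xy (h : Intertwined A B) (hG : Maps G (schurInv B)ᵀ Bᵀ A (schurInv A) T) :
    Maps (B⁻¹ * G * Bᵀ) A (schurInv A) (schurInv B)ᵀ Bᵀ T := by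
  have h1 := (h.map_B_yx.inv h.right.isUnit h.schurInvertible_coeff).comp (hG.comp h.map_Bt_xy)
  rw [← Matrix.mul_assoc] at h1
  exact h1.congr_right (hadamard_schurInv h.schurInvertible_coeff T)

theorem conj_yx (h : Intertwined A B) (hG : Maps G A (schurInv A) (schurInv B) B T) :
    Maps (B⁻¹ * G * Bᵀ) (schurInv B) B A (schurInv A) T := by
  have h1 := (h.map_B_xy.inv h.right.isUnit h.schurInvertible_coeff).comp (hG.comp h.map_Bt_yx)
  rw [← Matrix.mul_assoc] at h1
  exact h1.congr_right (hadamard_schurInv h.schurInvertible_coeff T)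

/-- Duality for the Nomura algebra of a symmetric type II matrix. -/
theorem dual_xx (h : Intertwined A B) (hF : Maps F A (schurInv A) A (schurInv A) S) :
    Maps S A (schurInv A) A (schurInv A) ((Fintype.card ι : ℂ) • Fᵀ) := by
  have h1 := (hF.exchange h.left.schurInv h.left.schurInvertible).swap
  rwa [schurInv_schurInv, ← schurInv_transpose, h.symm, Matrix.transpose_smul] at h1

/-- Duality applied twice returns the transpose, with a factor n on both sides that cancels. -/
theorem transpose_xx (h : Intertwined A B) (hF : Maps F A (schurInv A) A (schurInv A) S) :
    Maps Fᵀ A (schurInv A) A (schurInv A) Sᵀ := by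
  exact Maps.of_smul card_ne_zero_complex (h.dual_xx (h.dual_xx hF))

theorem dual_yy (h : Intertwined A B) (hF : Maps F (schurInv B) B (schurInv B) B S) :
    Maps Sᵀ Bᵀ (schurInv B)ᵀ Bᵀ (schurInv B)ᵀ ((Fintype.card ι : ℂ) • Fᵀ) := by
  have h1 := (hF.swap.exchange h.right.schurInv h.right.schurInvertible).swap
  rwa [schurInv_schurInv, Matrix.transpose_smul] at h1

theorem dual_yy_symm (h : Intertwined A B) (hF : Maps F Bᵀ (schurInv B)ᵀ Bᵀ (schurInv B)ᵀ S) :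
    Maps Sᵀ (schurInv B) B (schurInv B) B ((Fintype.card ι : ℂ) • Fᵀ) := by
  have h1 := (hF.swap.exchange h.right.transpose h.right.schurInv.schurInvertible.transpose).swap
  simpa [← schurInv_transpose, schurInv_schurInv] using h1

/-- The Nomura algebra of `A` is contained in that of `B`. -/
theorem maps_yy (h : Intertwined A B) (hF : Maps F A (schurInv A) A (schurInv A) S) :
    Maps F (schurInv B) B (schurInv B) B (B⁻¹ * S * B) := by
  -- Dualise so that S becomes the operator, transport it from x to y along B, and dualise back: F
  -- reappears, now acting on y'.
  have h1 := (h.conj_yy (h.dual_xx hF)).swap.exchange h.right.schurInv.transpose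
    h.right.schurInvertible.transpose
  simp only [Matrix.transpose_smul, Matrix.transpose_transpose, ← schurInv_transpose,
    schurInv_schurInv] at h1
  exact Maps.of_smul card_ne_zero_complex h1

/-- G B^T goes x → y → x, hence it is also diagonal on y' by `maps_yy`; undoing B^T : y' → x leaves
G : x → y'. -/
theorem exists_maps_xy (h : Intertwined A B) (hG : Maps G (schurInv B)ᵀ Bᵀ A (schurInv A) T) :
    ∃ T', Maps G A (schurInv A) (schurInv B) B T' := by
  have h1 := h.maps_yy (hG.comp h.map_Bt_xy)
  have h2 := h1.comp
    (h.map_Bt_yx.inv h.transpose.right.isUnit h.schurInvertible_coeff)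
  rw [Matrix.mul_assoc, Matrix.mul_nonsing_inv _
    ((Matrix.isUnit_iff_isUnit_det _).1 h.transpose.right.isUnit), Matrix.mul_one] at h2
  exact ⟨_, h2⟩

/-- Exchange in both directions. It turns membership in the dual space N'_{A,B} into the statement
that a matrix carries y to x. -/
theorem maps_pair_iff (h : Intertwined A B) {R : Matrix ι ι ℂ} :
    Maps R A B A B S ↔
      Maps S (schurInv B)ᵀ Bᵀ A (schurInv A) ((Fintype.card ι : ℂ) • Rᵀ) := by
  constructor
  · intro hR
    have h1 := (hR.exchange h.right h.left.schurInvertible).swap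
    rwa [← schurInv_transpose A, h.symm, Matrix.transpose_smul] at h1
  · intro hS
    have h1 := hS.swap.exchange h.right.schurInv.transpose h.left.schurInvertible.schurInv
    simp only [Matrix.transpose_smul, Matrix.transpose_transpose, ← schurInv_transpose,
      schurInv_schurInv, h.symm] at h1
    exact Maps.of_smul card_ne_zero_complex h1

theorem maps_pair_inv_iff (h : Intertwined A B) {R : Matrix ι ι ℂ} :
    Maps R (schurInv B)ᵀ (schurInv A) (schurInv B)ᵀ (schurInv A) S ↔
      Maps S A (schurInv A) (schurInv B) B ((Fintype.card ι : ℂ) • Rᵀ) := by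
  constructor
  · intro hR
    have h1 := (hR.exchange h.left.schurInv h.right.schurInvertible.schurInv.transpose).swap
    simpa only [Matrix.transpose_smul, Matrix.transpose_transpose, ← schurInv_transpose,
      schurInv_schurInv, h.symm] using h1
  · intro hS
    have h1 := hS.swap.exchange h.left h.right.schurInvertible
    simp only [Matrix.transpose_smul, Matrix.transpose_transpose, ← schurInv_transpose,
      h.symm] at h1
    exact Maps.of_smul card_ne_zero_complex h1

theorem maps_pair_transpose_iff (h : Intertwined A B) {R : Matrix ι ι ℂ} :
    Maps R A Bᵀ A Bᵀ S ↔
      Maps S (schurInv B) B A (schurInv A) ((Fintype.card ι : ℂ) • Rᵀ) := by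
  simpa only [schurInv_transpose, Matrix.transpose_transpose] using h.transpose.maps_pair_iff

theorem maps_pair_inv_transpose_iff (h : Intertwined A B) {R : Matrix ι ι ℂ} :
    Maps R (schurInv B) (schurInv A) (schurInv B) (schurInv A) S ↔
      Maps S A (schurInv A) (schurInv B)ᵀ Bᵀ ((Fintype.card ι : ℂ) • Rᵀ) := by
  simpa only [schurInv_transpose, Matrix.transpose_transpose] using h.transpose.maps_pair_inv_iff

/-- By exchange S carries y to x with coefficients n R^T, so S B^T is diagonal on x with
coefficients n² A ∘ R^T. Dualising and transposing makes A ∘ R the operator. -/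
theorem maps_hadamard_xx (h : Intertwined A B) {R : Matrix ι ι ℂ} (hR : Maps R A B A B S) :
    Maps (A ⊙ R) A (schurInv A) A (schurInv A) ((Fintype.card ι : ℂ)⁻¹ • (S * Bᵀ)) := by
  have h1 := h.transpose_xx (h.dual_xx ((h.maps_pair_iff.1 hR).comp h.map_Bt_xy))
  have hn : (Fintype.card ι : ℂ) ≠ 0 := card_ne_zero_complex
  refine Maps.of_smul (mul_ne_zero hn hn) ?_
  convert h1 using 1
  · ext i j
    have := congrFun (congrFun h.symm i) j
    simp only [Matrix.transpose_apply] at this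
    simp [this]; ring
  · simp [smul_smul]

/-- Composing S : x → y' with B^T : y' → x puts S B^T on y' with coefficients n² A ∘ Rᵀ, which is
then dualised. The step is reversible because the coefficients n A_ij of B^T are nonzero. -/
theorem maps_hadamard_yy_iff (h : Intertwined A B) {R : Matrix ι ι ℂ} :
    Maps S A (schurInv A) (schurInv B) B ((Fintype.card ι : ℂ) • Rᵀ) ↔
      Maps (A ⊙ R) Bᵀ (schurInv B)ᵀ Bᵀ (schurInv B)ᵀ
        ((Fintype.card ι : ℂ)⁻¹ • (S * Bᵀ)ᵀ) := by
  have hn : (Fintype.card ι : ℂ) ≠ 0 := card_ne_zero_complex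
  have hs : ∀ i j, A j i = A i j := fun i j => congrFun (congrFun h.symm i) j
  constructor
  · intro hS
    have h1 := h.dual_yy (hS.comp h.map_Bt_yx)
    refine Maps.of_smul (mul_ne_zero hn hn) ?_
    convert h1 using 1
    · ext i j
      simp [hs i j]; ring
    · simp only [smul_smul, mul_assoc, mul_inv_cancel₀ hn, mul_one]
  · intro hR
    have h1 := (h.dual_yy_symm hR).smul (Fintype.card ι : ℂ)
    have h2 := h1.comp (h.map_Bt_yx.inv h.transpose.right.isUnit h.schurInvertible_coeff)
    convert h2 using 1
    · rw [Matrix.transpose_smul, smul_smul, mul_inv_cancel₀ hn, one_smul,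
        Matrix.transpose_transpose, Matrix.mul_assoc, Matrix.mul_nonsing_inv _
          ((Matrix.isUnit_iff_isUnit_det _).1 h.transpose.right.isUnit), Matrix.mul_one]
    · ext i j
      have := h.left.schurInvertible i j
      simp [hs i j, schurInv_apply]
      field_simp

end Intertwined

/-! ### Nomura algebras and Θ in terms of `Maps`. -/

section Nomura

theorem mem_nomuraPair_iff {P Q M : Matrix ι ι ℂ} :
    M ∈ nomuraPair P Q ↔ ∃ S, Maps M P Q P Q S := by
  constructor
  · intro h
    choose c hc using h
    exact ⟨Matrix.of c, hc⟩
  · rintro ⟨S, hS⟩ i j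
    exact ⟨S i j, hS i j⟩

theorem maps_thetaPair {P Q : Matrix ι ι ℂ} (M : nomuraPair P Q) :
    Maps M P Q P Q (thetaPair P Q M) := fun i j => (M.2 i j).choose_spec

theorem mem_dualNomuraPair_iff {P Q S : Matrix ι ι ℂ} (hP : SchurInvertible P)
    (hQ : SchurInvertible Q) : S ∈ dualNomuraPair P Q ↔ ∃ M, Maps M P Q P Q S := by
  constructor
  · rintro ⟨M, rfl⟩
    exact ⟨M, maps_thetaPair M⟩
  · rintro ⟨M, hM⟩
    exact ⟨⟨M, mem_nomuraPair_iff.2 ⟨S, hM⟩⟩, (maps_thetaPair _).coeff_unique hM hP hQ⟩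

end Nomura

namespace Intertwined

variable {S R R₁ : Matrix ι ι ℂ}

/-- Both values of Θ are n⁻¹ S B^T up to transposition, S being the eigenvalue matrix of R. With
`maps_pair_inv_iff`, condition 2 thus says that R₁ has the same eigenvalue matrix S on the vectors
B^{(-)T} e_i ∘ A^{(-)} e_j. -/
theorem theta_condition_iff (h : Intertwined A B) (hR : Maps R A B A B S) :
    (∃ (hR₁ : A ⊙ R₁ ∈ nomura Bᵀ) (hR : A ⊙ R ∈ nomura A),
      (theta Bᵀ ⟨A ⊙ R₁, hR₁⟩)ᵀ = theta A ⟨A ⊙ R, hR⟩) ↔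
    Maps S A (schurInv A) (schurInv B) B ((Fintype.card ι : ℂ) • R₁ᵀ) := by
  have hA := h.left.schurInvertible
  have hB := h.right.schurInvertible.transpose
  have h1 := h.maps_hadamard_xx hR
  have hmem : A ⊙ R ∈ nomura A := mem_nomuraPair_iff.2 ⟨_, h1⟩
  have h2 : theta A ⟨A ⊙ R, hmem⟩ = (Fintype.card ι : ℂ)⁻¹ • (S * Bᵀ) :=
    (maps_thetaPair _).coeff_unique h1 hA hA.schurInv
  rw [h.maps_hadamard_yy_iff]
  constructor
  · rintro ⟨hR₁, _, e⟩
    rw [h2] at e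
    rw [← Matrix.transpose_smul, ← e, Matrix.transpose_transpose]
    exact maps_thetaPair (P := Bᵀ) (Q := schurInv Bᵀ) ⟨A ⊙ R₁, hR₁⟩
  · intro h3
    have hmem₁ : A ⊙ R₁ ∈ nomura Bᵀ := mem_nomuraPair_iff.2 ⟨_, h3⟩
    refine ⟨hmem₁, hmem, ?_⟩
    have h4 : theta Bᵀ ⟨A ⊙ R₁, hmem₁⟩ = (Fintype.card ι : ℂ)⁻¹ • (S * Bᵀ)ᵀ :=
      (maps_thetaPair _).coeff_unique h3 hB hB.schurInv
    rw [h2, h4]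
    simp

end Intertwined

end

section

variable {ι : Type*} [Fintype ι] [DecidableEq ι]

/-! ### Block matrices invariant under the half swap, on symmetric and antisymmetric vectors. -/

section Blocks

/-- The vector with four given blocks. -/
def quad (p q r s : ι → ℂ) : (ι ⊕ ι) ⊕ (ι ⊕ ι) → ℂ :=
  Sum.elim (Sum.elim p q) (Sum.elim r s)

theorem quad_inj {p q r s p' q' r' s' : ι → ℂ} :
    quad p q r s = quad p' q' r' s' ↔ p = p' ∧ q = q' ∧ r = r' ∧ s = s' := by
  simp only [quad, Sum.elim_eq_iff, and_assoc]

theorem smul_quad (c : ℂ) (p q r s : ι → ℂ) :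
    c • quad p q r s = quad (c • p) (c • q) (c • r) (c • s) := by
  ext ((i | i) | (i | i)) <;> rfl

theorem quad_mul_quad (p q r s p' q' r' s' : ι → ℂ) :
    quad p q r s * quad p' q' r' s' = quad (p * p') (q * q') (r * r') (s * s') := by
  ext ((i | i) | (i | i)) <;> rfl

/-- The `4n × 4n` matrices commuting with the swap of the two halves of each `2n`-block. -/
def swapBlocks (F R G H G₁ H₁ F₁ R₁ : Matrix ι ι ℂ) :
    Matrix ((ι ⊕ ι) ⊕ (ι ⊕ ι)) ((ι ⊕ ι) ⊕ (ι ⊕ ι)) ℂ :=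
  blocks4 (F + R) (F - R) (G + H) (G - H) (F - R) (F + R) (G - H) (G + H)
    (G₁ + H₁) (G₁ - H₁) (F₁ + R₁) (F₁ - R₁) (G₁ - H₁) (G₁ + H₁) (F₁ - R₁) (F₁ + R₁)

variable {F R G H G₁ H₁ F₁ R₁ : Matrix ι ι ℂ} {p q : ι → ℂ}

theorem swapBlocks_mulVec_symm :
    swapBlocks F R G H G₁ H₁ F₁ R₁ *ᵥ quad p p q q =
      (2 : ℂ) • quad (F *ᵥ p + G *ᵥ q) (F *ᵥ p + G *ᵥ q) (G₁ *ᵥ p + F₁ *ᵥ q)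
        (G₁ *ᵥ p + F₁ *ᵥ q) := by
  rw [smul_quad]
  ext ((i | i) | (i | i)) <;>
  · simp [swapBlocks, blocks4, quad, Matrix.fromBlocks_mulVec, Matrix.add_mulVec,
      Matrix.sub_mulVec]
    ring

theorem swapBlocks_mulVec_antisymm :
    swapBlocks F R G H G₁ H₁ F₁ R₁ *ᵥ quad p (-p) q (-q) =
      (2 : ℂ) • quad (R *ᵥ p + H *ᵥ q) (-(R *ᵥ p + H *ᵥ q)) (H₁ *ᵥ p + R₁ *ᵥ q)
        (-(H₁ *ᵥ p + R₁ *ᵥ q)) := by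
  rw [smul_quad]
  ext ((i | i) | (i | i)) <;>
  · simp [swapBlocks, blocks4, quad, Matrix.fromBlocks_mulVec, Matrix.add_mulVec,
      Matrix.sub_mulVec, Matrix.mulVec_neg]
    ring

theorem exists_eigenvalue_symm_iff :
    (∃ c : ℂ, swapBlocks F R G H G₁ H₁ F₁ R₁ *ᵥ quad p p q q = c • quad p p q q) ↔
      ∃ c : ℂ, F *ᵥ p + G *ᵥ q = c • p ∧ G₁ *ᵥ p + F₁ *ᵥ q = c • q := by
  simp only [swapBlocks_mulVec_symm, smul_quad, quad_inj]
  constructor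
  · rintro ⟨c, h1, -, h2, -⟩
    refine ⟨2⁻¹ * c, ?_, ?_⟩
    · rw [mul_smul, ← h1, smul_smul, inv_mul_cancel₀ two_ne_zero, one_smul]
    · rw [mul_smul, ← h2, smul_smul, inv_mul_cancel₀ two_ne_zero, one_smul]
  · rintro ⟨c, h1, h2⟩
    refine ⟨2 * c, ?_⟩
    rw [h1, h2]
    simp only [smul_smul, and_self]

theorem exists_eigenvalue_antisymm_iff :
    (∃ c : ℂ, swapBlocks F R G H G₁ H₁ F₁ R₁ *ᵥ quad p (-p) q (-q) = c • quad p (-p) q (-q)) ↔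
      ∃ c : ℂ, R *ᵥ p + H *ᵥ q = c • p ∧ H₁ *ᵥ p + R₁ *ᵥ q = c • q := by
  simp only [swapBlocks_mulVec_antisymm, smul_quad, quad_inj]
  constructor
  · rintro ⟨c, h1, -, h2, -⟩
    refine ⟨2⁻¹ * c, ?_, ?_⟩
    · rw [mul_smul, ← h1, smul_smul, inv_mul_cancel₀ two_ne_zero, one_smul]
    · rw [mul_smul, ← h2, smul_smul, inv_mul_cancel₀ two_ne_zero, one_smul]
  · rintro ⟨c, h1, h2⟩
    refine ⟨2 * c, ?_⟩
    rw [h1, h2]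
    simp only [smul_smul, smul_neg, and_self]

/-- The matrix `[[F, G], [G₁, F₁]]` has `(ε p, δ q)` as an eigenvector for all signs. -/
theorem forall_sign_iff (F G G₁ F₁ : Matrix ι ι ℂ) (p q : ι → ℂ) :
    (∀ ε δ : ℤˣ, ∃ c : ℂ, F *ᵥ (ε • p) + G *ᵥ (δ • q) = c • ε • p ∧
      G₁ *ᵥ (ε • p) + F₁ *ᵥ (δ • q) = c • δ • q) ↔
    ∃ s t : ℂ, F *ᵥ p = s • p ∧ F₁ *ᵥ q = s • q ∧ G *ᵥ q = t • p ∧ G₁ *ᵥ p = t • q := by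
  constructor
  · intro h
    obtain ⟨a, h1, h2⟩ := h 1 1
    obtain ⟨b, h3, h4⟩ := h 1 (-1)
    simp only [one_smul, Units.neg_smul, Matrix.mulVec_neg] at h1 h2 h3 h4
    -- Here a and b are the eigenvalues at (p, q) and (p, -q); half the sum and half the difference
    -- of the two equations isolate the diagonal and off-diagonal blocks.
    refine ⟨(a + b) / 2, (a - b) / 2, ?_, ?_, ?_, ?_⟩ <;> ext k <;>
    · have h1 := congrFun h1 k
      have h2 := congrFun h2 k
      have h3 := congrFun h3 k
      have h4 := congrFun h4 k
      simp only [Pi.add_apply, Pi.smul_apply, Pi.neg_apply, smul_eq_mul] at h1 h2 h3 h4 ⊢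
      first
        | linear_combination (h1 + h3) / 2
        | linear_combination (h1 - h3) / 2
        | linear_combination (h2 + h4) / 2
        | linear_combination (h2 - h4) / 2
  · rintro ⟨s, t, h1, h2, h3, h4⟩ ε δ
    rcases Int.units_eq_one_or ε with rfl | rfl <;> rcases Int.units_eq_one_or δ with rfl | rfl
    · refine ⟨s + t, ?_, ?_⟩ <;>
        simp only [one_smul, h1, h2, h3, h4] <;> module
    · refine ⟨s - t, ?_, ?_⟩ <;>
        simp only [one_smul, Units.neg_smul, Matrix.mulVec_neg, h1, h2, h3, h4] <;> module
    · refine ⟨s - t, ?_, ?_⟩ <;>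
        simp only [one_smul, Units.neg_smul, Matrix.mulVec_neg, h1, h2, h3, h4] <;> module
    · refine ⟨s + t, ?_, ?_⟩ <;>
        simp only [one_smul, Units.neg_smul, Matrix.mulVec_neg, h1, h2, h3, h4] <;> module

end Blocks

/-! ### Columns of V and their entrywise products. -/

section ColumnsOfV

variable {A B : Matrix ι ι ℂ} {d : ℂ}

/-- The index of a column within its half, with the sign of its half. -/
def colIndex (i : ι) (ε : ℤˣ) : ι ⊕ ι := if ε = 1 then Sum.inl i else Sum.inr i

theorem forall_colIndex {p : ι ⊕ ι → Prop} : (∀ a, p a) ↔ ∀ i ε, p (colIndex i ε) := by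
  constructor
  · exact fun h i ε => h _
  · rintro h (i | i)
    · exact h i 1
    · exact h i (-1)

theorem col_V_inl (i : ι) (ε : ℤˣ) : (V A B d).col (Sum.inl (colIndex i ε)) =
    quad (ε • d • A.col i) (-(ε • d • A.col i)) ((schurInv B)ᵀ.col i) ((schurInv B)ᵀ.col i) := by
  rcases Int.units_eq_one_or ε with rfl | rfl <;> ext ((k | k) | (k | k)) <;>
    simp [V, blocks4, quad, colIndex]

theorem col_V_inr (i : ι) (ε : ℤˣ) : (V A B d).col (Sum.inr (colIndex i ε)) =
    quad ((schurInv B).col i) ((schurInv B).col i) (ε • d • A.col i) (-(ε • d • A.col i)) := by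
  rcases Int.units_eq_one_or ε with rfl | rfl <;> ext ((k | k) | (k | k)) <;>
    simp [V, blocks4, quad, colIndex]

theorem schurInv_V : schurInv (V A B d) = V (schurInv A) (schurInv B) d⁻¹ := by
  ext ((i | i) | (i | i)) ((k | k) | (k | k)) <;>
    simp [V, blocks4, schurInv_apply, mul_comm]

end ColumnsOfV

variable {A B : Matrix ι ι ℂ} {d : ℂ} {F R G H G₁ H₁ F₁ R₁ : Matrix ι ι ℂ}

/-- `[[F, G], [G₁, F₁]]` has the vectors `(± P e_i ∘ Q e_j, ± P' e_i ∘ Q' e_j)` as eigenvectors. -/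
def MapsPair (F G G₁ F₁ P Q P' Q' : Matrix ι ι ℂ) : Prop :=
  ∃ S T, Maps F P Q P Q S ∧ Maps F₁ P' Q' P' Q' S ∧ Maps G P' Q' P Q T ∧ Maps G₁ P Q P' Q' T

theorem forall_exists_iff_mapsPair {F G G₁ F₁ P Q P' Q' : Matrix ι ι ℂ} :
    (∀ i j, ∃ s t : ℂ, F *ᵥ (P.col i * Q.col j) = s • (P.col i * Q.col j) ∧
      F₁ *ᵥ (P'.col i * Q'.col j) = s • (P'.col i * Q'.col j) ∧
      G *ᵥ (P'.col i * Q'.col j) = t • (P.col i * Q.col j) ∧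
      G₁ *ᵥ (P.col i * Q.col j) = t • (P'.col i * Q'.col j)) ↔
    MapsPair F G G₁ F₁ P Q P' Q' := by
  constructor
  · intro h
    choose s t h1 h2 h3 h4 using h
    exact ⟨Matrix.of s, Matrix.of t, h1, h2, h3, h4⟩
  · rintro ⟨S, T, h1, h2, h3, h4⟩ i j
    exact ⟨S i j, T i j, h1 i j, h2 i j, h3 i j, h4 i j⟩

theorem forall_eigenvector_symm_iff {P Q P' Q' : Matrix ι ι ℂ} :
    (∀ i j, ∀ ε δ : ℤˣ, ∃ c : ℂ, swapBlocks F R G H G₁ H₁ F₁ R₁ *ᵥ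
      quad (ε • (P.col i * Q.col j)) (ε • (P.col i * Q.col j))
        (δ • (P'.col i * Q'.col j)) (δ • (P'.col i * Q'.col j)) =
      c • quad (ε • (P.col i * Q.col j)) (ε • (P.col i * Q.col j))
        (δ • (P'.col i * Q'.col j)) (δ • (P'.col i * Q'.col j))) ↔
    MapsPair F G G₁ F₁ P Q P' Q' := by
  rw [← forall_exists_iff_mapsPair]
  refine forall₂_congr fun i j => ?_
  simp only [exists_eigenvalue_symm_iff]
  exact forall_sign_iff F G G₁ F₁ _ _

theorem forall_eigenvector_antisymm_iff {P Q P' Q' : Matrix ι ι ℂ} :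
    (∀ i j, ∀ ε δ : ℤˣ, ∃ c : ℂ, swapBlocks F R G H G₁ H₁ F₁ R₁ *ᵥ
      quad (ε • (P.col i * Q.col j)) (-(ε • (P.col i * Q.col j)))
        (δ • (P'.col i * Q'.col j)) (-(δ • (P'.col i * Q'.col j))) =
      c • quad (ε • (P.col i * Q.col j)) (-(ε • (P.col i * Q.col j)))
        (δ • (P'.col i * Q'.col j)) (-(δ • (P'.col i * Q'.col j)))) ↔
    MapsPair R H H₁ R₁ P Q P' Q' := by
  rw [← forall_exists_iff_mapsPair]
  refine forall₂_congr fun i j => ?_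
  simp only [exists_eigenvalue_antisymm_iff]
  exact forall_sign_iff R H H₁ R₁ _ _

theorem exists_eigenvalue_neg {κ : Type*} [Fintype κ] {Z : Matrix κ κ ℂ} {v : κ → ℂ} :
    (∃ c : ℂ, Z *ᵥ (-v) = c • -v) ↔ ∃ c : ℂ, Z *ᵥ v = c • v := by
  simp only [Matrix.mulVec_neg, smul_neg, neg_inj]

end

section

variable {ι : Type*} [Fintype ι] [DecidableEq ι]

variable {A B : Matrix ι ι ℂ} {d : ℂ} {F R G H G₁ H₁ F₁ R₁ : Matrix ι ι ℂ}

theorem col_smul (c : ℂ) (C : Matrix ι ι ℂ) (i : ι) : (c • C).col i = c • C.col i := rfl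

theorem neg_quad (p q r s : ι → ℂ) : -quad p q r s = quad (-p) (-q) (-r) (-s) := by
  ext ((i | i) | (i | i)) <;> rfl

/-- Only the relative sign of the two halves matters, since negating an eigenvector changes nothing.
This gives the products in which only the A-part carries a sign the same form as the others. -/
theorem forall_sign_left_iff {Z : Matrix ((ι ⊕ ι) ⊕ (ι ⊕ ι)) ((ι ⊕ ι) ⊕ (ι ⊕ ι)) ℂ}
    {p q : ι → ℂ} :
    (∀ ε δ : ℤˣ, ∃ c : ℂ, Z *ᵥ quad ((ε * δ) • p) ((ε * δ) • p) q q =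
      c • quad ((ε * δ) • p) ((ε * δ) • p) q q) ↔
    ∀ ε δ : ℤˣ, ∃ c : ℂ, Z *ᵥ quad (ε • p) (ε • p) (δ • q) (δ • q) =
      c • quad (ε • p) (ε • p) (δ • q) (δ • q) := by
  constructor
  · intro h ε δ
    rcases Int.units_eq_one_or δ with rfl | rfl
    · simpa using h ε 1
    · rw [← exists_eigenvalue_neg]
      simpa [neg_quad] using h ε (-1)
  · intro h ε δ
    simpa using h (ε * δ) 1

theorem forall_sign_right_iff {Z : Matrix ((ι ⊕ ι) ⊕ (ι ⊕ ι)) ((ι ⊕ ι) ⊕ (ι ⊕ ι)) ℂ}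
    {p q : ι → ℂ} :
    (∀ ε δ : ℤˣ, ∃ c : ℂ, Z *ᵥ quad p p ((ε * δ) • q) ((ε * δ) • q) =
      c • quad p p ((ε * δ) • q) ((ε * δ) • q)) ↔
    ∀ ε δ : ℤˣ, ∃ c : ℂ, Z *ᵥ quad (ε • p) (ε • p) (δ • q) (δ • q) =
      c • quad (ε • p) (ε • p) (δ • q) (δ • q) := by
  constructor
  · intro h ε δ
    rcases Int.units_eq_one_or ε with rfl | rfl
    · simpa using h 1 δ
    · rw [← exists_eigenvalue_neg]
      simpa [neg_quad] using h (-1) δ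
  · intro h ε δ
    simpa using h 1 (ε * δ)

section

variable (i j : ι) (ε δ : ℤˣ)

theorem col_V_mul_inl_inl (hd : d ≠ 0) :
    (V A B d).col (Sum.inl (colIndex i ε)) * (schurInv (V A B d)).col (Sum.inl (colIndex j δ)) =
      quad ((ε * δ) • (A.col i * (schurInv A).col j)) ((ε * δ) • (A.col i * (schurInv A).col j))
        ((schurInv B)ᵀ.col i * Bᵀ.col j) ((schurInv B)ᵀ.col i * Bᵀ.col j) := by
  rw [schurInv_V, col_V_inl, col_V_inl, quad_mul_quad, schurInv_schurInv]
  rcases Int.units_eq_one_or ε with rfl | rfl <;> rcases Int.units_eq_one_or δ with rfl | rfl <;>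
    simp [smul_smul, hd]

theorem col_V_mul_inr_inr (hd : d ≠ 0) :
    (V A B d).col (Sum.inr (colIndex i ε)) * (schurInv (V A B d)).col (Sum.inr (colIndex j δ)) =
      quad ((schurInv B).col i * B.col j) ((schurInv B).col i * B.col j)
        ((ε * δ) • (A.col i * (schurInv A).col j)) ((ε * δ) • (A.col i * (schurInv A).col j)) := by
  rw [schurInv_V, col_V_inr, col_V_inr, quad_mul_quad, schurInv_schurInv]
  rcases Int.units_eq_one_or ε with rfl | rfl <;> rcases Int.units_eq_one_or δ with rfl | rfl <;>
    simp [smul_smul, hd]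

theorem col_V_mul_inl_inr :
    (V A B d).col (Sum.inl (colIndex i ε)) * (schurInv (V A B d)).col (Sum.inr (colIndex j δ)) =
      quad (ε • ((d • A).col i * B.col j)) (-(ε • ((d • A).col i * B.col j)))
        (δ • ((d⁻¹ • (schurInv B)ᵀ).col i * (schurInv A).col j))
        (-(δ • ((d⁻¹ • (schurInv B)ᵀ).col i * (schurInv A).col j))) := by
  rw [schurInv_V, col_V_inl, col_V_inr, quad_mul_quad, schurInv_schurInv]
  rcases Int.units_eq_one_or ε with rfl | rfl <;> rcases Int.units_eq_one_or δ with rfl | rfl <;>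
    simp [col_smul]

theorem col_V_mul_inr_inl :
    (V A B d).col (Sum.inr (colIndex i ε)) * (schurInv (V A B d)).col (Sum.inl (colIndex j δ)) =
      quad (δ • ((d⁻¹ • schurInv B).col i * (schurInv A).col j))
        (-(δ • ((d⁻¹ • schurInv B).col i * (schurInv A).col j)))
        (ε • ((d • A).col i * Bᵀ.col j)) (-(ε • ((d • A).col i * Bᵀ.col j))) := by
  rw [schurInv_V, col_V_inr, col_V_inl, quad_mul_quad, schurInv_schurInv]
  rcases Int.units_eq_one_or ε with rfl | rfl <;> rcases Int.units_eq_one_or δ with rfl | rfl <;>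
    simp [col_smul]

end

theorem swapBlocks_mem_nomura_V_iff (hd : d ≠ 0) :
    swapBlocks F R G H G₁ H₁ F₁ R₁ ∈ nomura (V A B d) ↔
      MapsPair F G G₁ F₁ A (schurInv A) (schurInv B)ᵀ Bᵀ ∧
      MapsPair F G G₁ F₁ (schurInv B) B A (schurInv A) ∧
      MapsPair R H H₁ R₁ (d • A) B (d⁻¹ • (schurInv B)ᵀ) (schurInv A) ∧
      MapsPair R H H₁ R₁ (d⁻¹ • schurInv B) (schurInv A) (d • A) Bᵀ := by
  have h0 : swapBlocks F R G H G₁ H₁ F₁ R₁ ∈ nomura (V A B d) ↔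
      ∀ a b, ∃ c : ℂ, swapBlocks F R G H G₁ H₁ F₁ R₁ *ᵥ
        ((V A B d).col a * (schurInv (V A B d)).col b) =
          c • ((V A B d).col a * (schurInv (V A B d)).col b) := Iff.rfl
  rw [h0]
  simp only [Sum.forall (p := fun a : (ι ⊕ ι) ⊕ (ι ⊕ ι) => ∀ b, _),
    Sum.forall (p := fun b : (ι ⊕ ι) ⊕ (ι ⊕ ι) => ∃ c : ℂ, _), forall_colIndex,
    col_V_mul_inl_inl _ _ _ _ hd, col_V_mul_inr_inr _ _ _ _ hd, col_V_mul_inl_inr, col_V_mul_inr_inl,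
    forall_and]
  rw [← forall_eigenvector_symm_iff (R := R) (H := H) (H₁ := H₁) (R₁ := R₁),
    ← forall_eigenvector_symm_iff (R := R) (H := H) (H₁ := H₁) (R₁ := R₁),
    ← forall_eigenvector_antisymm_iff (F := F) (G := G) (G₁ := G₁) (F₁ := F₁),
    ← forall_eigenvector_antisymm_iff (F := F) (G := G) (G₁ := G₁) (F₁ := F₁)]
  simp only [← forall_sign_left_iff (p := A.col _ * _), ← forall_sign_right_iff (q := A.col _ * _)]
  constructor
  -- The signs trade places in `h3`: in `col_V_mul_inr_inl` the sign of the second column sits on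
  -- the first half.
  · rintro ⟨⟨h1, h3⟩, h2, h4⟩
    exact ⟨fun i j ε δ => h1 i ε j δ, fun i j ε δ => h4 i ε j δ, fun i j ε δ => h2 i ε j δ,
      fun i j ε δ => h3 i δ j ε⟩
  · rintro ⟨h1, h4, h2, h3⟩
    exact ⟨⟨fun i ε j δ => h1 i j ε δ, fun i ε j δ => h3 i j δ ε⟩, fun i ε j δ => h2 i j ε δ,
      fun i ε j δ => h4 i j ε δ⟩

/-! ### Elements of N_V commute with the half swap. -/

theorem isUnit_V [Nonempty ι] (hA : IsTypeII A) (hB : IsTypeII B) (hd : d ≠ 0) :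
    IsUnit (V A B d) := by
  have hn : (Fintype.card ι : ℂ) ≠ 0 := card_ne_zero_complex
  refine IsUnit.of_mul_eq_one ((4 * Fintype.card ι : ℂ)⁻¹ • (schurInv (V A B d))ᵀ) ?_
  have h1 := hA.mul_schurInv
  have h2 := hB.schurInv.mul_schurInv
  have h3 := hB.schurInv.transpose.mul_schurInv
  simp only [schurInv_transpose, schurInv_schurInv, Matrix.transpose_transpose] at h2 h3
  have h4 : V A B d * (schurInv (V A B d))ᵀ = (4 * Fintype.card ι : ℂ) • 1 := by
    rw [schurInv_V]
    simp only [V, blocks4, schurInv_schurInv, Matrix.fromBlocks_transpose,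
      Matrix.fromBlocks_multiply, Matrix.transpose_smul, Matrix.transpose_neg,
      Matrix.transpose_transpose, Matrix.neg_mul, Matrix.mul_neg, Matrix.smul_mul, Matrix.mul_smul,
      smul_smul, smul_neg, neg_neg, h1, h2, h3, ← mul_assoc, inv_mul_cancel₀ hd, one_mul,
      ← Matrix.fromBlocks_one, Matrix.fromBlocks_smul, Matrix.fromBlocks_add, smul_zero,
      ← Matrix.fromBlocks_zero, Matrix.fromBlocks_inj]
    and_intros <;> module
  rw [Matrix.mul_smul, h4, smul_smul, inv_mul_cancel₀ (mul_ne_zero (by norm_num) hn), one_smul]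

/-- The permutation exchanging the halves of each `2n`-block. -/
def halfSwap : (ι ⊕ ι) ⊕ (ι ⊕ ι) ≃ (ι ⊕ ι) ⊕ (ι ⊕ ι) :=
  Equiv.sumCongr (Equiv.sumComm ι ι) (Equiv.sumComm ι ι)

/-- V is invertible and has no zero entry, so the eigenvectors span. The half swap multiplies each
of them by a sign σ, and conjugating by it introduces σ² = 1, so the eigenvalues do not change. -/
theorem submatrix_halfSwap_of_mem_nomura_V [Nonempty ι] (hA : IsTypeII A) (hB : IsTypeII B)
    (hd : d ≠ 0) {Z : Matrix ((ι ⊕ ι) ⊕ (ι ⊕ ι)) ((ι ⊕ ι) ⊕ (ι ⊕ ι)) ℂ}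
    (hZ : Z ∈ nomura (V A B d)) : Z.submatrix halfSwap halfSwap = Z := by
  have hV : SchurInvertible (schurInv (V A B d)) := by
    refine SchurInvertible.schurInv ?_
    have h1 := hA.schurInvertible
    have h2 := hB.schurInvertible
    rintro ((i | i) | (i | i)) ((j | j) | (j | j)) <;>
      simp [V, blocks4, hd, schurInv_apply, h1 i j, h2 i j, h2 j i]
  refine eq_of_mulVec_eq (isUnit_V hA hB hd) hV fun a b => ?_
  have hv : ∃ σ : ℂ, σ * σ = 1 ∧
      ((V A B d).col a * (schurInv (V A B d)).col b) ∘ halfSwap =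
        σ • ((V A B d).col a * (schurInv (V A B d)).col b) := by
    rcases a with a | a <;> rcases b with b | b
    · refine ⟨1, by ring, ?_⟩
      revert a b
      simp only [forall_colIndex, col_V_mul_inl_inl _ _ _ _ hd]
      intro i ε j δ
      ext ((k | k) | (k | k)) <;> simp [halfSwap, quad]
    · refine ⟨-1, by ring, ?_⟩
      revert a b
      simp only [forall_colIndex, col_V_mul_inl_inr]
      intro i ε j δ
      ext ((k | k) | (k | k)) <;> simp [halfSwap, quad]
    · refine ⟨-1, by ring, ?_⟩
      revert a b
      simp only [forall_colIndex, col_V_mul_inr_inl]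
      intro i ε j δ
      ext ((k | k) | (k | k)) <;> simp [halfSwap, quad]
    · refine ⟨1, by ring, ?_⟩
      revert a b
      simp only [forall_colIndex, col_V_mul_inr_inr _ _ _ _ hd]
      intro i ε j δ
      ext ((k | k) | (k | k)) <;> simp [halfSwap, quad]
  obtain ⟨c, hc⟩ := hZ a b
  obtain ⟨σ, hσ, hv⟩ := hv
  set v := (V A B d).col a * (schurInv (V A B d)).col b
  have hinv : (halfSwap : (ι ⊕ ι) ⊕ (ι ⊕ ι) ≃ _).symm = halfSwap := by
    ext ((k | k) | (k | k)) <;> rfl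
  rw [Matrix.submatrix_mulVec_equiv, hinv, hv, Matrix.mulVec_smul, hc]
  show σ • c • (v ∘ halfSwap) = c • v
  rw [hv, smul_smul, smul_smul, mul_right_comm, hσ, one_mul]

theorem exists_eq_swapBlocks {Z : Matrix ((ι ⊕ ι) ⊕ (ι ⊕ ι)) ((ι ⊕ ι) ⊕ (ι ⊕ ι)) ℂ}
    (hZ : Z.submatrix halfSwap halfSwap = Z) :
    ∃ F R G H G₁ H₁ F₁ R₁, Z = swapBlocks F R G H G₁ H₁ F₁ R₁ := by
  refine ⟨(2⁻¹ : ℂ) • (Z.toBlocks₁₁.toBlocks₁₁ + Z.toBlocks₁₁.toBlocks₁₂),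
    (2⁻¹ : ℂ) • (Z.toBlocks₁₁.toBlocks₁₁ - Z.toBlocks₁₁.toBlocks₁₂),
    (2⁻¹ : ℂ) • (Z.toBlocks₁₂.toBlocks₁₁ + Z.toBlocks₁₂.toBlocks₁₂),
    (2⁻¹ : ℂ) • (Z.toBlocks₁₂.toBlocks₁₁ - Z.toBlocks₁₂.toBlocks₁₂),
    (2⁻¹ : ℂ) • (Z.toBlocks₂₁.toBlocks₁₁ + Z.toBlocks₂₁.toBlocks₁₂),
    (2⁻¹ : ℂ) • (Z.toBlocks₂₁.toBlocks₁₁ - Z.toBlocks₂₁.toBlocks₁₂),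
    (2⁻¹ : ℂ) • (Z.toBlocks₂₂.toBlocks₁₁ + Z.toBlocks₂₂.toBlocks₁₂),
    (2⁻¹ : ℂ) • (Z.toBlocks₂₂.toBlocks₁₁ - Z.toBlocks₂₂.toBlocks₁₂), ?_⟩
  ext ((i | i) | (i | i)) ((j | j) | (j | j)) <;>
  · simp [swapBlocks, blocks4, Matrix.toBlocks₁₁, Matrix.toBlocks₁₂, Matrix.toBlocks₂₁,
      Matrix.toBlocks₂₂]
    -- The blocks in the upper row of each 2n-block are identities; those in the lower row use swap
    -- invariance.
    first
      | ring1
      | (ring_nf; exact (congrFun (congrFun hZ _) _).symm)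

end

/-! ### The symmetric relations and conditions 2 and 3. -/

section

variable {ι : Type*} [Fintype ι] [DecidableEq ι] [Nonempty ι]

variable {A B : Matrix ι ι ℂ} {d : ℂ} {F R G H G₁ H₁ F₁ R₁ : Matrix ι ι ℂ}

namespace Intertwined

/-- F₁ must agree with B⁻¹ F B on the spanning family y, and G₁ with B⁻¹ G B^T on the spanning
family x. The second pair of relations follows from the first through `maps_yy` and
`exists_maps_xy`. -/
theorem mapsPair_symm_iff (h : Intertwined A B) :
    MapsPair F G G₁ F₁ A (schurInv A) (schurInv B)ᵀ Bᵀ ∧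
      MapsPair F G G₁ F₁ (schurInv B) B A (schurInv A) ↔
    (F ∈ nomura A ∧ G ∈ dualNomuraPair A B) ∧ F₁ = B⁻¹ * F * B ∧ G₁ = B⁻¹ * G * Bᵀ := by
  have hA := h.left.schurInvertible
  have hB := h.right.schurInvertible
  rw [mem_dualNomuraPair_iff hA hB]
  constructor
  · rintro ⟨⟨S, T, hF, hF₁, hG, hG₁⟩, -⟩
    refine ⟨⟨mem_nomuraPair_iff.2 ⟨S, hF⟩, (Fintype.card ι : ℂ)⁻¹ • Tᵀ, h.maps_pair_iff.2 ?_⟩,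
      hF₁.unique (h.conj_yy hF) h.right.schurInv.transpose.isUnit hB.transpose,
      hG₁.unique (h.conj_xy hG) h.left.isUnit hA.schurInv⟩
    refine hG.congr_right ?_
    rw [Matrix.transpose_smul, Matrix.transpose_transpose, smul_smul,
      mul_inv_cancel₀ card_ne_zero_complex, one_smul]
  · rintro ⟨⟨hF, M, hM⟩, rfl, rfl⟩
    obtain ⟨S, hF⟩ := mem_nomuraPair_iff.1 hF
    have hG := h.maps_pair_iff.1 hM
    obtain ⟨T', hG'⟩ := h.exists_maps_xy hG
    exact ⟨⟨S, _, hF, h.conj_yy hF, hG, h.conj_xy hG⟩,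
      ⟨_, T', h.maps_yy hF, h.conj_xx (h.maps_yy hF), hG', h.conj_yx hG'⟩⟩

/-- The second pair of relations is again automatic: transporting S along B and B^T gives its common
eigenvalue matrix B⁻¹ S B^T. -/
theorem exists_maps_antisymm_iff (h : Intertwined A B) :
    (∃ S, Maps R A B A B S ∧
        Maps R₁ (schurInv B)ᵀ (schurInv A) (schurInv B)ᵀ (schurInv A) S) ∧
      (∃ S, Maps R (schurInv B) (schurInv A) (schurInv B) (schurInv A) S ∧
        Maps R₁ A Bᵀ A Bᵀ S) ↔
    R ∈ nomuraPair A B ∧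
      ∃ (hR₁ : A ⊙ R₁ ∈ nomura Bᵀ) (hR : A ⊙ R ∈ nomura A),
        (theta Bᵀ ⟨A ⊙ R₁, hR₁⟩)ᵀ = theta A ⟨A ⊙ R, hR⟩ := by
  constructor
  · rintro ⟨⟨S, hR, hR₁⟩, -⟩
    exact ⟨mem_nomuraPair_iff.2 ⟨S, hR⟩,
      (h.theta_condition_iff hR).2 (h.maps_pair_inv_iff.1 hR₁)⟩
  · rintro ⟨hR, hθ⟩
    obtain ⟨S, hR⟩ := mem_nomuraPair_iff.1 hR
    have h1 := h.maps_pair_iff.1 hR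
    have h2 := (h.theta_condition_iff hR).1 hθ
    exact ⟨⟨S, hR, h.maps_pair_inv_iff.2 h2⟩,
      ⟨B⁻¹ * S * Bᵀ, h.maps_pair_inv_transpose_iff.2 (h.conj_xy h1),
        h.maps_pair_transpose_iff.2 (h.conj_yx h2)⟩⟩

theorem exists_operator_iff (h : Intertwined A B) :
    (∃ S S₁ : Matrix ι ι ℂ,
      X A⁻¹ * Δ (schurInv B) * X H * Δ (schurInv A) * X B⁻¹ = Δ S ∧
      Δ S = X B * Δ A * X H₁ * Δ B * X A ∧
      X Bᵀ * Δ A * X H * Δ Bᵀ * X A = Δ S₁ ∧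
      Δ S₁ = X A⁻¹ * Δ (schurInv B)ᵀ * X H₁ * Δ (schurInv A) * X (B⁻¹)ᵀ) ↔
    (∃ S, Maps H (schurInv B)ᵀ (schurInv A) A B ((Fintype.card ι : ℂ) • S) ∧
      Maps H₁ A B (schurInv B)ᵀ (schurInv A) ((Fintype.card ι : ℂ)⁻¹ • S)) ∧
    ∃ S, Maps H A Bᵀ (schurInv B) (schurInv A) ((Fintype.card ι : ℂ)⁻¹ • S) ∧
      Maps H₁ (schurInv B) (schurInv A) A Bᵀ ((Fintype.card ι : ℂ) • S) := by
  have hA := h.left.schurInvertible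
  have hB := h.right.schurInvertible
  have hAu := (Matrix.isUnit_iff_isUnit_det _).1 h.left.isUnit
  have hBu := (Matrix.isUnit_iff_isUnit_det _).1 h.right.isUnit
  have hn : (Fintype.card ι : ℂ)⁻¹ ≠ 0 := inv_ne_zero card_ne_zero_complex
  -- The factors n and n⁻¹ in the coefficients come from replacing B⁻¹ by n⁻¹ B^{(-)T}.
  have hBi : B⁻¹ = (Fintype.card ι : ℂ)⁻¹ • (schurInv B)ᵀ := h.right.inv_eq
  have hBt : (B⁻¹)ᵀ = (Fintype.card ι : ℂ)⁻¹ • schurInv B := by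
    rw [hBi, Matrix.transpose_smul, Matrix.transpose_transpose]
  have hBt' : Bᵀ * (B⁻¹)ᵀ = 1 := by
    rw [← Matrix.transpose_mul, Matrix.nonsing_inv_mul _ hBu, Matrix.transpose_one]
  have e1 : ∀ S, X A⁻¹ * Δ (schurInv B) * X H * Δ (schurInv A) * X B⁻¹ = Δ S ↔
      Maps H (schurInv B)ᵀ (schurInv A) A B ((Fintype.card ι : ℂ) • S) := fun S => by
    rw [operator_iff_maps (Matrix.nonsing_inv_mul _ hAu) hB.schurInv (schurInv_schurInv B), hBi,
      maps_smul_source hn, inv_inv]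
  have e2 : ∀ S, Δ S = X B * Δ A * X H₁ * Δ B * X A ↔
      Maps H₁ A B (schurInv B)ᵀ (schurInv A) ((Fintype.card ι : ℂ)⁻¹ • S) := fun S => by
    rw [eq_comm, operator_iff_maps (Matrix.mul_nonsing_inv _ hBu) hA rfl, hBi, maps_smul_target]
  have e3 : ∀ S, X Bᵀ * Δ A * X H * Δ Bᵀ * X A = Δ S ↔
      Maps H A Bᵀ (schurInv B) (schurInv A) ((Fintype.card ι : ℂ)⁻¹ • S) := fun S => by
    rw [operator_iff_maps hBt' hA rfl, hBt, maps_smul_target]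
  have e4 : ∀ S, Δ S = X A⁻¹ * Δ (schurInv B)ᵀ * X H₁ * Δ (schurInv A) * X (B⁻¹)ᵀ ↔
      Maps H₁ (schurInv B) (schurInv A) A Bᵀ ((Fintype.card ι : ℂ) • S) := fun S => by
    rw [eq_comm, operator_iff_maps (Matrix.nonsing_inv_mul _ hAu) hB.schurInv.transpose
      (schurInv_schurInv Bᵀ), hBt, maps_smul_source hn, inv_inv]
  simp only [e1, e2, e3, e4]
  constructor
  · rintro ⟨S, S₁, h1, h2, h3, h4⟩
    exact ⟨⟨S, h1, h2⟩, S₁, h3, h4⟩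
  · rintro ⟨⟨S, h1, h2⟩, S₁, h3, h4⟩
    exact ⟨S, S₁, h1, h2, h3, h4⟩

theorem mapsPair_antisymm_iff (h : Intertwined A B) (hd : d ^ 2 = (Fintype.card ι : ℂ)) :
    MapsPair R H H₁ R₁ (d • A) B (d⁻¹ • (schurInv B)ᵀ) (schurInv A) ∧
      MapsPair R H H₁ R₁ (d⁻¹ • schurInv B) (schurInv A) (d • A) Bᵀ ↔
    (R ∈ nomuraPair A B ∧
      ∃ (hR₁ : A ⊙ R₁ ∈ nomura Bᵀ) (hR : A ⊙ R ∈ nomura A),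
        (theta Bᵀ ⟨A ⊙ R₁, hR₁⟩)ᵀ = theta A ⟨A ⊙ R, hR⟩) ∧
    ∃ S S₁ : Matrix ι ι ℂ,
      X A⁻¹ * Δ (schurInv B) * X H * Δ (schurInv A) * X B⁻¹ = Δ S ∧
      Δ S = X B * Δ A * X H₁ * Δ B * X A ∧
      X Bᵀ * Δ A * X H * Δ Bᵀ * X A = Δ S₁ ∧
      Δ S₁ = X A⁻¹ * Δ (schurInv B)ᵀ * X H₁ * Δ (schurInv A) * X (B⁻¹)ᵀ := by
  have hd0 : d ≠ 0 := by
    rintro rfl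
    exact card_ne_zero_complex (ι := ι) (by rw [← hd]; ring)
  have e1 : d * d = (Fintype.card ι : ℂ) := by rw [← hd, sq]
  have e2 : d⁻¹ * d⁻¹ = (Fintype.card ι : ℂ)⁻¹ := by rw [← e1, mul_inv]
  rw [h.exists_operator_iff, ← h.exists_maps_antisymm_iff]
  -- The scalars d and d⁻¹ cancel for R and R₁, while for H and H₁ they combine to d² = n or d⁻² =
  -- n⁻¹, exactly the factors in `exists_operator_iff`.
  simp only [MapsPair, maps_smul_source hd0, maps_smul_source (inv_ne_zero hd0), maps_smul_target,
    smul_smul, inv_inv, inv_mul_cancel₀ hd0, mul_inv_cancel₀ hd0, one_smul, e1, e2]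
  constructor
  · rintro ⟨⟨S, T, h1, h2, h3, h4⟩, S', T', h5, h6, h7, h8⟩
    exact ⟨⟨⟨S, h1, h2⟩, S', h5, h6⟩, ⟨T, h3, h4⟩, T', h7, h8⟩
  · rintro ⟨⟨⟨S, h1, h2⟩, S', h5, h6⟩, ⟨T, h3, h4⟩, T', h7, h8⟩
    exact ⟨⟨S, T, h1, h2, h3, h4⟩, S', T', h5, h6, h7, h8⟩

end Intertwined

end

end JonesPair

/-! ### The description of N_V. -/

theorem mainTheorem3 (n : ℕ) (A B : Matrix (Fin n) (Fin n) ℂ) (d : ℂ)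
    (hd : d ^ 2 = (n : ℂ))
    (hAB : JonesPair.IsInvertibleJonesPair A B) (hA : A.IsSymm) :
    (JonesPair.nomura (JonesPair.V A B d) : Set (Matrix _ _ ℂ)) =
      {Z | ∃ F R G H R₁ H₁ : Matrix (Fin n) (Fin n) ℂ,
        F ∈ JonesPair.nomura A ∧
        R ∈ JonesPair.nomuraPair A B ∧
        G ∈ JonesPair.dualNomuraPair A B ∧
        (∃ (hR₁ : A ⊙ R₁ ∈ JonesPair.nomura Bᵀ) (hR : A ⊙ R ∈ JonesPair.nomura A),
          (JonesPair.theta Bᵀ ⟨A ⊙ R₁, hR₁⟩)ᵀ = JonesPair.theta A ⟨A ⊙ R, hR⟩) ∧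
        (∃ S S₁ : Matrix (Fin n) (Fin n) ℂ,
          JonesPair.X A⁻¹ * JonesPair.Δ (JonesPair.schurInv B) * JonesPair.X H *
              JonesPair.Δ (JonesPair.schurInv A) * JonesPair.X B⁻¹ = JonesPair.Δ S ∧
          JonesPair.Δ S =
            JonesPair.X B * JonesPair.Δ A * JonesPair.X H₁ * JonesPair.Δ B * JonesPair.X A ∧
          JonesPair.X Bᵀ * JonesPair.Δ A * JonesPair.X H *
              JonesPair.Δ Bᵀ * JonesPair.X A = JonesPair.Δ S₁ ∧
          JonesPair.Δ S₁ =
            JonesPair.X A⁻¹ * JonesPair.Δ (JonesPair.schurInv B)ᵀ * JonesPair.X H₁ *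
              JonesPair.Δ (JonesPair.schurInv A) * JonesPair.X (B⁻¹)ᵀ) ∧
        Z = JonesPair.blocks4
          (F + R)              (F - R)              (G + H)              (G - H)
          (F - R)              (F + R)              (G - H)              (G + H)
          (B⁻¹ * G * Bᵀ + H₁)  (B⁻¹ * G * Bᵀ - H₁)  (B⁻¹ * F * B + R₁)   (B⁻¹ * F * B - R₁)
          (B⁻¹ * G * Bᵀ - H₁)  (B⁻¹ * G * Bᵀ + H₁)  (B⁻¹ * F * B - R₁)   (B⁻¹ * F * B + R₁)} := by
  -- For n = 0 all matrices are equal and both sets are everything; there d = 0, so the case has to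
  -- be separated from the argument that divides by n and d.
  rcases Nat.eq_zero_or_pos n with rfl | hn
  · refine Set.ext fun Z => iff_of_true ?_ ?_
    · rw [Subsingleton.elim Z 1]
      exact one_mem _
    · refine ⟨0, 0, 0, 0, 0, 0, zero_mem _, zero_mem _, ⟨0, Subsingleton.elim _ _⟩,
        ⟨?_, ?_, Subsingleton.elim _ _⟩, ⟨0, 0, ?_, ?_, ?_, ?_⟩, Subsingleton.elim _ _⟩
      · rw [Matrix.hadamard_zero]; exact zero_mem _
      · rw [Matrix.hadamard_zero]; exact zero_mem _
      all_goals exact LinearMap.ext fun M => Subsingleton.elim _ _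
  · have : Nonempty (Fin n) := ⟨⟨0, hn⟩⟩
    have h := hAB.intertwined hA
    have hd' : d ^ 2 = (Fintype.card (Fin n) : ℂ) := by rw [hd, Fintype.card_fin]
    have hd0 : d ≠ 0 := by
      rintro rfl
      exact JonesPair.card_ne_zero_complex (ι := Fin n) (by rw [← hd']; ring)
    ext Z
    constructor
    · intro hZ
      obtain ⟨F, R, G, H, G₁, H₁, F₁, R₁, rfl⟩ := JonesPair.exists_eq_swapBlocks
        (JonesPair.submatrix_halfSwap_of_mem_nomura_V h.left h.right hd0 hZ)
      have h1 := (JonesPair.swapBlocks_mem_nomura_V_iff hd0).1 hZ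
      rw [← and_assoc, h.mapsPair_symm_iff, h.mapsPair_antisymm_iff hd'] at h1
      obtain ⟨⟨⟨hF, hG⟩, rfl, rfl⟩, ⟨hR, hθ⟩, hop⟩ := h1
      exact ⟨F, R, G, H, R₁, H₁, hF, hR, hG, hθ, hop, rfl⟩
    · rintro ⟨F, R, G, H, R₁, H₁, hF, hR, hG, hθ, hop, rfl⟩
      refine (JonesPair.swapBlocks_mem_nomura_V_iff hd0).2 ?_
      rw [← and_assoc, h.mapsPair_symm_iff, h.mapsPair_antisymm_iff hd']
      exact ⟨⟨⟨hF, hG⟩, rfl, rfl⟩, ⟨hR, hθ⟩, hop⟩
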